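/- Let $\lambda>\aleph_1$ be a regular cardinal. A ray in a graph is a one-way infinite path; two rays are tail-equivalent if they share a common tail (final segment). Let $\mathcal G$ be the class of graphs $G$ such that for every vertex $v$ the subgraph of $G$ induced on the neighbourhood of $v$ has at most one ray up to tail-equivalence, and let $\mathcal G_\lambda$ be the collection of isomorphism types of graphs in $\mathcal G$ with exactly $\lambda$ vertices, quasi-ordered by $G\le_w H$ iff $G$ is isomorphic to a (not necessarily induced) subgraph of $H$. For a set $A$ let $[A]^{\le\lambda}$ be the set of subsets of $A$ of cardinality at most $\lambda$, ordered by inclusion; for an ideal $I$ over $\lambda$ let $([A]^{\le\lambda},\subseteq)^\lambda/I$ be the reduced power: classes of sequences $\langle A_\delta:\delta<\lambda\rangle$ modulo $I$, with $[\langle A_\delta\rangle]\le[\langle B_\delta\rangle]$ iff $\{\delta: A_\delta\not\subseteq B_\delta\}\in I$. A homomorphism is an order-preserving map. Let $\mathcal P(\omega)/\mathrm{fin}$ be the set of subsets of $\omega$ modulo finite symmetric difference. A club guessing sequence is a sequence $\bar C=\langle c_\delta:\delta\in S\rangle$, with $S\subseteq\lambda$ stationary, such that each $c_\delta\subseteq\delta$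 has order type $\omega$ and $\sup c_\delta=\delta$, and such that for every club $E\subseteq\lambda$ the set $\{\delta\in S:c_\delta\subseteq E\}$ is stationary. Let $\mathrm{id}^b(\bar C)$ be the set of those $X\subseteq\lambda$ for which there is a club $E\subseteq\lambda$ such that for no $\delta\in S\cap E\cap X$ is an end segment of $c_\delta$ contained in $E$. Then there are a club guessing sequence $\bar C$ such that $I=\mathrm{id}^b(\bar C)$ is a normal ideal over $\lambda$ (proper, containing all bounded sets, $\lambda$-complete, closed under diagonal unions), and a surjective homomorphism $$\Phi:\langle\mathcal G_\lambda,\le_w\rangle\to([\mathbb R]^{\le\lambda},\subseteq),$$ with the following properties. (a) $\Phi=\psi\circ\varphi$ for a surjective homomorphism $\varphi:\langle\mathcal G_\lambda,\le_w\rangle\to([\mathbb R]^{\le\lambda},\subseteq)^\lambda/I$ and the surjective homomorphism $\psi:([\mathbb R]^{\le\lambda},\subseteq)^\lambda/I\to([\mathbb R]^{\le\lambda},\subseteq)$ given by $\psi([\langle A_\delta\rangle])=\{x:\{\delta<\lambda:x\in A_\delta\}\notin I\}$. (b) The same holds with $\mathcal P(\omega)/\mathrm{fin}$ in the reduced power: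 for some bijection $e:\mathcal P(\omega)/\mathrm{fin}\to\mathbb R$, $\Phi=\psi'\circ\varphi'$ for a surjective homomorphism $\varphi':\langle\mathcal G_\lambda,\le_w\rangle\to([\mathcal P(\omega)/\mathrm{fin}]^{\le\lambda},\subseteq)^\lambda/I$ and the surjective homomorphism $\psi':([\mathcal P(\omega)/\mathrm{fin}]^{\le\lambda},\subseteq)^\lambda/I\to([\mathbb R]^{\le\lambda},\subseteq)$ given by $\psi'([\langle A_\delta\rangle])=e[\{x:\{\delta<\lambda:x\in A_\delta\}\notin I\}]$. -/

import Mathlib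

open Cardinal

universe u v

namespace RayGraphs

/-! ### Rays and the class of graphs -/

/-- A ray in `G`: a one-way infinite path, given by the sequence of its (distinct) vertices. -/
structure Ray {V : Type u} (G : SimpleGraph V) where
  /-- The vertices of the ray, in order. -/
  vert : ℕ → V
  injective : Function.Injective vert
  adj : ∀ n, G.Adj (vert n) (vert (n + 1))

/-- Two rays are tail-equivalent when they share a common tail.  The tails of a ray are its
final segments. -/
def Ray.TailEquiv {V : Type u} {G : SimpleGraph V} (R S : Ray G) : Prop :=
  ∃ m n : ℕ, ∀ k : ℕ, R.vert (m + k) = S.vert (n + k)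

/-- The class of graphs in which, for every vertex `v`, the subgraph induced on the neighbourhood
of `v` has at most one ray up to tail-equivalence. -/
def InClass {V : Type u} (G : SimpleGraph V) : Prop :=
  ∀ v : V, ∀ R S : Ray (G.induce (G.neighborSet v)), R.TailEquiv S

/-- A graph in the class with exactly `κ` vertices. -/
structure ClassGraph (κ : Cardinal.{u}) where
  /-- The vertex set. -/
  V : Type u
  /-- The graph. -/
  graph : SimpleGraph V
  card_eq : #V = κ
  inClass : InClass graph

/-- Isomorphism of graphs in the class. -/
instance classGraphSetoid (κ : Cardinal.{u}) : Setoid (ClassGraph κ) where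
  r G H := Nonempty (G.graph ≃g H.graph)
  iseqv :=
    { refl := fun _ => ⟨SimpleGraph.Iso.refl⟩
      symm := fun ⟨e⟩ => ⟨e.symm⟩
      trans := fun ⟨e⟩ ⟨f⟩ => ⟨f.comp e⟩ }

/-- The isomorphism types of graphs of cardinality `κ` in the class. -/
def IsoTypes (κ : Cardinal.{u}) : Type (u + 1) :=
  Quotient (classGraphSetoid κ)

/-- Weak embeddability of isomorphism types: `G` is isomorphic to a (not necessarily induced)
subgraph of `H`. -/
def WeakEmb {κ : Cardinal.{u}} : IsoTypes κ → IsoTypes κ → Prop :=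
  Quotient.lift₂ (fun G H => SimpleGraph.IsContained G.graph H.graph)
    (fun _ _ _ _ ⟨e⟩ ⟨f⟩ => propext
      ⟨fun ⟨c⟩ => ⟨(f.toCopy.comp c).comp e.symm.toCopy⟩,
       fun ⟨c⟩ => ⟨(f.symm.toCopy.comp c).comp e.toCopy⟩⟩)

/-- Isomorphism types are quasi-ordered by weak embeddability. -/
instance isoTypesPreorder (κ : Cardinal.{u}) : Preorder (IsoTypes κ) where
  le := WeakEmb
  le_refl a := by
    induction a using Quotient.inductionOn with
    | h G => exact SimpleGraph.IsContained.refl G.graph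
  le_trans a b c := by
    induction a using Quotient.inductionOn with
    | h G =>
      induction b using Quotient.inductionOn with
      | h H =>
        induction c using Quotient.inductionOn with
        | h K => exact fun h k => SimpleGraph.IsContained.trans h k

/-! ### Small subsets and the power set of `ω` modulo finite sets -/

/-- The subsets of `A` of cardinality at most `κ`, partially ordered by inclusion. -/
abbrev SmallSubsets (A : Type v) (κ : Cardinal.{u}) : Type v :=
  {s : Set A // Cardinal.lift.{u} #s ≤ Cardinal.lift.{v} κ}

/-- Equality modulo a finite set. -/
instance modFinSetoid : Setoid (Set ℕ) where
  r X Y := (symmDiff X Y).Finite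
  iseqv :=
    { refl := fun X => by simp
      symm := fun {X Y} h => by rwa [symmDiff_comm]
      trans := fun {X Y Z} h k => (h.union k).subset (symmDiff_triangle X Y Z) }

/-- `P(ω)/fin`. -/
def PowModFin : Type :=
  Quotient modFinSetoid

/-! ### Club guessing and ideals over `κ` -/

/-- The set of ordinals below (the initial ordinal of) `κ`. -/
abbrev Below (κ : Cardinal.{u}) : Type (u + 1) :=
  Set.Iio κ.ord

/-- `c` is almost contained in `E`: an end segment of `c` is contained in `E`. -/
def AlmostSubset {κ : Cardinal.{u}} (c E : Set (Below κ)) : Prop :=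
  ∃ β ∈ c, ∀ γ ∈ c, β ≤ γ → γ ∈ E

/-- `⟨C δ : δ ∈ S⟩` is a club guessing sequence on the stationary set `S ⊆ κ`, with every `C δ`
cofinal in `δ` and of order type `ω`.  The values of `C` outside `S` are irrelevant. -/
structure IsClubGuessing {κ : Cardinal.{u}} (S : Set (Below κ)) (C : Below κ → Set (Below κ)) :
    Prop where
  stationary : IsStationary S
  subset : ∀ δ ∈ S, C δ ⊆ Set.Iio δ
  isLUB : ∀ δ ∈ S, IsLUB (C δ) δ
  type_eq : ∀ δ ∈ S, Nonempty (ℕ ≃o C δ)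
  guess : ∀ E : Set (Below κ), IsClub E → IsStationary {δ | δ ∈ S ∧ C δ ⊆ E}

/-- Membership in the guessing ideal `id^b(C)`: for some club `E`, no `δ ∈ S ∩ E ∩ X` has `C δ`
almost contained in `E`. -/
def GuessingNull {κ : Cardinal.{u}} (S : Set (Below κ)) (C : Below κ → Set (Below κ))
    (X : Set (Below κ)) : Prop :=
  ∃ E : Set (Below κ), IsClub E ∧ ∀ δ ∈ S ∩ E ∩ X, ¬ AlmostSubset (C δ) E

/-- A normal ideal over `κ`: proper, containing all bounded sets, `κ`-complete and closed under
diagonal unions. -/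
structure IsNormalIdeal {κ : Cardinal.{u}} (I : Order.Ideal (Set (Below κ))) : Prop where
  proper : Set.univ ∉ I
  bounded : ∀ β : Below κ, Set.Iio β ∈ I
  complete : ∀ F : Set (Set (Below κ)), #F < Cardinal.lift.{u + 1} κ → (∀ X ∈ F, X ∈ I) →
    ⋃₀ F ∈ I
  diagonal : ∀ X : Below κ → Set (Below κ), (∀ α, X α ∈ I) → {δ | ∃ α < δ, δ ∈ X α} ∈ I

/-- The dual filter of an ideal of sets. -/
def dualFilter {κ : Cardinal.{u}} (I : Order.Ideal (Set (Below κ))) : Filter (Below κ) :=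
  Filter.comk (fun X => X ∈ I) I.bot_mem (fun _ ht _ hs => I.lower hs ht)
    (fun _ hs _ ht => I.sup_mem hs ht)

/-- The reduced power `([A]^{≤ κ}, ⊆)^κ / I`, consisting of the classes of sequences modulo `I`
and partially ordered by inclusion on all coordinates outside a set from `I`. -/
abbrev ReducedPower (A : Type v) {κ : Cardinal.{u}} (I : Order.Ideal (Set (Below κ))) :
    Type (max (u + 1) v) :=
  Filter.Germ (dualFilter I) (SmallSubsets A κ)

/-- The elements which belong to `I`-positively many coordinates of a sequence. -/
def positivePart {A : Type v} {κ : Cardinal.{u}} (I : Order.Ideal (Set (Below κ)))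
    (s : Below κ → SmallSubsets A κ) : Set A :=
  {x | {δ | x ∈ (s δ).1} ∉ I}

end RayGraphs

universe w

/-!
Label the vertices of a graph by the ordinals below `κ`.  Along a ladder of order type `ω` climbing
to `δ`, a ray determines an element of `P(ω)/fin`: the set of those intervals of the ladder which it
visits.  Rays in the neighbourhood of a vertex share their tails, so each vertex codes at most one
class, and the graph codes at most `κ` classes at each `δ`.  A weak embedding moves the labels, but
it respects the initial segments below the points of some club.  If the ladders guess clubs, then
the sequence of the coded sets is therefore monotone modulo the guessing ideal.  Conversely, in the
tree of finite sequences of ordinals, joining one new vertex to every branch from a prescribed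
family produces any sequence of small sets of codes.

For `ℵ₁ < κ`, club guessing holds at cofinality `ω`: starting from arbitrary ladders, shrink a club
`ℵ₁` times, each time gluing the ladders to the club.  Rungs only move down, so the countably many
rungs of each ladder stabilise at some stage.
-/

namespace RayGraphs

open Filter Order Set

section Clubs

variable {α : Type v} [LinearOrder α]

theorem exists_forall_lt_of_mk_lt_cof {s : Set α} (hs : #s < cof α) : ∃ b, ∀ x ∈ s, x < b :=
  not_isCofinal_iff.1 fun h => (cof_le h).not_gt hs

theorem noMaxOrder_of_aleph0_lt_cof (hω : ℵ₀ < cof α) : NoMaxOrder α := by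
  have : Nonempty α := cof_ne_zero_iff.1 hω.ne_bot
  exact noTopOrder_iff_noMaxOrder α |>.1 (one_lt_cof_iff.1 (one_lt_aleph0.trans hω))

theorem mk_preimage_singleton_lt_cof (hω : ℵ₀ < cof α) {V : Type v} {p : V → α}
    (hp : p.Injective) (a : α) : #(p ⁻¹' {a}) < cof α :=
  (mk_le_one_iff_set_subsingleton.2 (subsingleton_singleton.preimage hp)).trans_lt
    (one_lt_aleph0.trans hω)

theorem foldr_max_lt_iff {z x : α} {l : List α} :
    l.foldr max z < x ↔ z < x ∧ ∀ y ∈ l, y < x := by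
  induction l with
  | nil => simp
  | cons y l ih => simp [ih, and_left_comm]

theorem isClub_Ioi [NoMaxOrder α] (b : α) : IsClub (Ioi b) where
  dirSupClosed := by
    rintro d hd ⟨y, hy⟩ - x hx
    exact lt_of_lt_of_le (hd hy) (hx.1 hy)
  isCofinal a := by
    obtain ⟨c, hc⟩ := exists_gt (max a b)
    exact ⟨c, (le_max_right a b).trans_lt hc, ((le_max_left a b).trans_lt hc).le⟩

variable [WellFoundedLT α]

theorem exists_isLUB_of_bddAbove {s : Set α} (hs : BddAbove s) : ∃ x, IsLUB s x :=
  ⟨wellFounded_lt.min _ hs, wellFounded_lt.min_mem _ hs,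
    fun _ hy => not_lt.1 (wellFounded_lt.not_lt_min _ hy)⟩

theorem exists_strictMono_isLUB (hω : ℵ₀ < cof α) {P : α → α → Prop}
    (hP : ∀ a, ∃ b, a < b ∧ P a b) (a : α) :
    ∃ (f : ℕ → α) (x : α), StrictMono f ∧ f 0 = a ∧ (∀ n, P (f n) (f (n + 1))) ∧
      IsLUB (range f) x := by
  choose g hg hgP using hP
  let f : ℕ → α := fun n => g^[n] a
  have hf : ∀ n, f (n + 1) = g (f n) := fun n => Function.iterate_succ_apply' g n a
  obtain ⟨b, hb⟩ := exists_forall_lt_of_mk_lt_cof (s := range f)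
    ((countable_range f).le_aleph0.trans_lt hω)
  obtain ⟨x, hx⟩ := exists_isLUB_of_bddAbove ⟨b, fun y hy => (hb y hy).le⟩
  exact ⟨f, x, strictMono_nat_of_lt_succ fun n => (hf n).symm ▸ hg _, rfl,
    fun n => (hf n).symm ▸ hgP _, hx⟩

theorem exists_isGreatest_inter_Iic {E : Set α} (hE : IsClub E) {x : α}
    (hne : (E ∩ Iic x).Nonempty) : ∃ y, IsGreatest (E ∩ Iic x) y := by
  obtain ⟨y, hy⟩ := exists_isLUB_of_bddAbove ⟨x, fun z (hz : z ∈ E ∩ Iic x) => hz.2⟩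
  exact ⟨y, ⟨hE.isLUB_mem inter_subset_left hne hy, hy.2 fun z hz => hz.2⟩, hy.1⟩

theorem nonempty_orderIso_nat [Nonempty α] [NoMaxOrder α] (hα : ∀ x : α, (Iio x).Finite) :
    Nonempty (ℕ ≃o α) := by
  have hIic : ∀ x : α, (Iic x).Finite := fun x => by
    rw [← Iio_union_right]
    exact (hα x).union (finite_singleton x)
  let _ : LocallyFiniteOrder α :=
    LocallyFiniteOrder.ofFiniteIcc fun x y => (hIic y).subset fun z hz => hz.2
  let _ : OrderBot α := WellFoundedLT.toOrderBot α
  let _ : SuccOrder α := LinearLocallyFiniteOrder.succOrder α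
  let _ : PredOrder α := LinearLocallyFiniteOrder.predOrder α
  exact ⟨orderIsoNatOfLinearSuccPredArch.symm⟩

end Clubs

section DiagonalIntersection

variable {α : Type v} [LinearOrder α] [WellFoundedLT α] [IsRegularCardinalOrder α]

theorem mk_Iio_lt_cof (a : α) : #(Iio a) < cof α := by
  rw [cof_eq_cardinalMk]
  exact mk_Iio_lt a ord_cardinalMk

theorem isClub_diagonal (hω : ℵ₀ < cof α) {E : α → Set α} (hE : ∀ a, IsClub (E a)) :
    IsClub {x | ∀ a < x, x ∈ E a} where
  dirSupClosed := by
    rintro d hd - - x hx a ha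
    obtain ⟨y, hy, hay⟩ := (lt_isLUB_iff hx).1 ha
    exact (hE a).isLUB_mem (t := d ∩ Ici y) (fun z hz => hd hz.1 a (hay.trans_le hz.2))
      ⟨y, hy, le_rfl⟩ (hx.inter_Ici_of_mem hy)
  isCofinal a := by
    have := noMaxOrder_of_aleph0_lt_cof hω
    have hstep (b : α) : ∃ c, b < c ∧ ∀ d < b, c ∈ E d := by
      have hb : IsClub (⋂ d : Iio b, E d) :=
        IsClub.iInter hω.ne' (by simpa only [Cardinal.lift_id] using mk_Iio_lt_cof b) fun d => hE d
      obtain ⟨b', hb'⟩ := exists_gt b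
      obtain ⟨c, hc, hc'⟩ := hb.isCofinal b'
      exact ⟨c, hb'.trans_le hc', fun d hd => mem_iInter.1 hc ⟨d, hd⟩⟩
    obtain ⟨f, x, hf, rfl, hfE, hx⟩ := exists_strictMono_isLUB hω hstep a
    refine ⟨x, fun b hb => ?_, hx.1 (mem_range_self 0)⟩
    obtain ⟨_, ⟨n, rfl⟩, hn⟩ := (lt_isLUB_iff hx).1 hb
    have hfn : f (n + 1) ∈ range f := mem_range_self _
    refine (hE b).isLUB_mem (t := range f ∩ Ici (f (n + 1))) ?_ ⟨_, hfn, le_rfl⟩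
      (hx.inter_Ici_of_mem hfn)
    rintro _ ⟨⟨m, rfl⟩, hm⟩
    obtain ⟨k, rfl⟩ := Nat.exists_eq_add_of_le' (hf.le_iff_le.1 hm)
    exact hfE (k + n) b (hn.trans_le (hf.monotone (n.le_add_left k)))

variable {V : Type v} {p q : V → α}

theorem isClub_lt_imp_lt (hω : ℵ₀ < cof α) (hp : ∀ a, #(p ⁻¹' {a}) < cof α) :
    IsClub {x | ∀ v, p v < x → q v < x} := by
  have := noMaxOrder_of_aleph0_lt_cof hω
  have hdiag := isClub_diagonal hω (E := fun a => ⋂ v : p ⁻¹' {a}, Ioi (q v)) fun a =>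
    IsClub.iInter hω.ne' (by simpa only [Cardinal.lift_id] using hp a) fun v => isClub_Ioi _
  refine (congrArg IsClub (Set.ext fun x => ?_)).mp hdiag
  simp only [mem_ofPred_eq, mem_iInter, mem_Ioi, Subtype.forall, mem_preimage, mem_singleton_iff]
  exact ⟨fun h v hv => h _ hv v rfl, fun h a ha v hv => h v (hv ▸ ha)⟩

theorem isClub_lt_iff_lt (hω : ℵ₀ < cof α) (hp : ∀ a, #(p ⁻¹' {a}) < cof α)
    (hq : ∀ a, #(q ⁻¹' {a}) < cof α) : IsClub {x | ∀ v, p v < x ↔ q v < x} := by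
  simp only [iff_iff_implies_and_implies, forall_and]
  exact (isClub_lt_imp_lt hω hp).inter hω.ne' (isClub_lt_imp_lt hω hq)

theorem mk_preimage_foldr_max_lt_cof (hω : ℵ₀ < cof α) (z a : α) :
    #((fun l : List α => l.foldr max z) ⁻¹' {a}) < cof α := by
  have := noMaxOrder_of_aleph0_lt_cof hω
  obtain ⟨b, hb⟩ := exists_gt a
  have hsub : (fun l : List α => l.foldr max z) ⁻¹' {a} ⊆
      range (List.map ((↑) : Iio b → α)) := by
    rintro l rfl
    rw [range_list_map_coe]
    exact (foldr_max_lt_iff.1 hb).2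
  refine ((mk_le_mk_of_subset hsub).trans mk_range_le).trans_lt ?_
  exact (mk_list_le_max _).trans_lt (max_lt hω (mk_Iio_lt_cof b))

theorem isClub_list_lt_iff (hω : ℵ₀ < cof α) {q : List α → α} (hq : q.Injective) :
    IsClub {x | ∀ l, q l < x ↔ ∀ y ∈ l, y < x} := by
  have := noMaxOrder_of_aleph0_lt_cof hω
  have hclub := (isClub_lt_iff_lt hω (mk_preimage_singleton_lt_cof hω hq)
    (mk_preimage_foldr_max_lt_cof hω (q []))).inter hω.ne' (isClub_Ioi (q []))
  refine (congrArg IsClub (Set.ext fun x => ?_)).mp hclub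
  simp only [foldr_max_lt_iff]
  refine ⟨fun ⟨h, hx⟩ l => (h l).trans (and_iff_right hx), fun h => ?_⟩
  have hx : q [] < x := (h []).2 (by simp)
  exact ⟨fun l => (h l).trans (and_iff_right hx).symm, hx⟩

end DiagonalIntersection

section ClubGuessing

variable {α : Type v} [LinearOrder α]

/-- The ladder `a` glued to the set `E`: every rung is moved down to the largest element of `E`
below it. -/
def gluedLadder (E : Set α) (a : ℕ → α) : Set α :=
  {y | ∃ n, IsGreatest (E ∩ Iic (a n)) y}

variable {E : Set α} {a : ℕ → α} {δ : α}

theorem gluedLadder_subset_Iio (ha : ∀ n, a n < δ) : gluedLadder E a ⊆ Iio δ := by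
  rintro y ⟨n, hn⟩
  exact hn.1.2.trans_lt (ha n)

theorem gluedLadder_inter_Iio_finite (hmono : Monotone a) {x : α} (hx : x ∈ gluedLadder E a) :
    (gluedLadder E a ∩ Iio x).Finite := by
  obtain ⟨n, hn⟩ := hx
  have hfin : (⋃ m ∈ Iio n, {y | IsGreatest (E ∩ Iic (a m)) y}).Finite :=
    (finite_Iio n).biUnion fun m _ => Subsingleton.finite fun y hy z hz => hy.unique hz
  refine hfin.subset ?_
  rintro y ⟨⟨m, hm⟩, hyx⟩
  refine mem_biUnion (mem_Iio.2 (not_le.1 fun hnm => ?_)) hm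
  exact (hm.2 ⟨hn.1.1, hn.1.2.trans (hmono hnm)⟩).not_gt hyx

variable [WellFoundedLT α]

theorem exists_isClub_chain {ι : Type v} [LinearOrder ι] [WellFoundedLT ι] (hω : cof α ≠ ℵ₀)
    (hι : #ι < cof α) {G : Set α → Set α} (hG : ∀ E, IsClub E → IsClub (G E)) :
    ∃ E : ι → Set α, (∀ i, IsClub (E i)) ∧ Antitone E ∧ ∀ i j, i < j → E j ⊆ G (E i) := by
  let E : ι → Set α := (wellFounded_lt (α := ι)).fix
    fun i e => ⋂ j : Iio i, e j.1 j.2 ∩ G (e j.1 j.2)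
  have hE_eq (i : ι) : E i = ⋂ j : Iio i, E j ∩ G (E j) := wellFounded_lt.fix_eq _ i
  have hE (i : ι) : IsClub (E i) := by
    induction i using WellFoundedLT.induction with
    | ind i ih =>
      rw [hE_eq]
      exact IsClub.iInter hω (by simpa only [Cardinal.lift_id] using (mk_set_le _).trans_lt hι)
        fun j => (ih j.1 j.2).inter hω (hG _ (ih j.1 j.2))
  have hlt {i j : ι} (hij : i < j) : E j ⊆ E i ∩ G (E i) := by
    rw [hE_eq j]
    exact iInter_subset (fun k : Iio j => E k ∩ G (E k)) ⟨i, hij⟩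
  refine ⟨E, hE, fun i j hij => ?_, fun i j hij => (hlt hij).trans inter_subset_right⟩
  rcases hij.eq_or_lt with rfl | h
  exacts [le_rfl, (hlt h).trans inter_subset_left]

theorem exists_forall_ge_isGreatest_iff {ι : Type*} [LinearOrder ι] [Nonempty ι] {E : ι → Set α}
    (hE : ∀ i, IsClub (E i)) (hanti : Antitone E) (x : α) :
    ∃ i, ∀ j ≥ i, ∀ y, IsGreatest (E j ∩ Iic x) y ↔ IsGreatest (E i ∩ Iic x) y := by
  by_cases h : ∃ i, E i ∩ Iic x = ∅
  · obtain ⟨i, hi⟩ := h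
    have hempty (j : ι) (hij : i ≤ j) : E j ∩ Iic x = ∅ :=
      subset_empty_iff.1 (hi ▸ inter_subset_inter_left _ (hanti hij))
    exact ⟨i, fun j hij y => by rw [hempty j hij, hi]⟩
  push Not at h
  choose m hm using fun i => exists_isGreatest_inter_Iic (hE i) (h i)
  obtain ⟨i, hi⟩ : ∃ i, ∀ j, m i ≤ m j := by
    obtain ⟨_, ⟨i, rfl⟩, hi⟩ := wellFounded_lt.has_min (range m) (range_nonempty m)
    exact ⟨i, fun j => not_lt.1 (hi _ (mem_range_self j))⟩
  refine ⟨i, fun j hij y => ?_⟩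
  have hmij : m j = m i := le_antisymm
    ((hm j).mono (hm i) (inter_subset_inter_left _ (hanti hij))) (hi j)
  rw [(hm j).isGreatest_iff_eq, (hm i).isGreatest_iff_eq, hmij]

theorem isLUB_gluedLadder (hE : IsClub E) (hEδ : IsLUB (E ∩ Iio δ) δ) (ha : ∀ n, a n < δ)
    (haδ : IsLUB (range a) δ) : IsLUB (gluedLadder E a) δ := by
  refine ⟨fun y hy => (gluedLadder_subset_Iio ha hy).le, fun b hb => not_lt.1 fun hbδ => ?_⟩
  obtain ⟨e, he, hbe⟩ := (lt_isLUB_iff hEδ).1 hbδ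
  obtain ⟨_, ⟨n, rfl⟩, hn⟩ := (lt_isLUB_iff haδ).1 he.2
  obtain ⟨y, hy⟩ := exists_isGreatest_inter_Iic hE ⟨e, he.1, hn.le⟩
  exact (hb ⟨n, hy⟩).not_gt (hbe.trans_le (hy.2 ⟨he.1, hn.le⟩))

theorem nonempty_orderIso_nat_gluedLadder (hmono : Monotone a) (ha : ∀ n, a n < δ)
    (hlub : IsLUB (gluedLadder E a) δ) : Nonempty (ℕ ≃o gluedLadder E a) := by
  have hgt {x : α} (hx : x < δ) : ∃ y ∈ gluedLadder E a, x < y := (lt_isLUB_iff hlub).1 hx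
  have : Nonempty (gluedLadder E a) :=
    let ⟨y, hy, _⟩ := hgt (ha 0)
    ⟨⟨y, hy⟩⟩
  have : NoMaxOrder (gluedLadder E a) := ⟨fun x =>
    let ⟨y, hy, hxy⟩ := hgt (gluedLadder_subset_Iio ha x.2)
    ⟨⟨y, hy⟩, hxy⟩⟩
  refine nonempty_orderIso_nat fun x => ?_
  exact ((gluedLadder_inter_Iio_finite hmono x.2).preimage Subtype.val_injective.injOn).subset
    fun y hy => ⟨y.2, hy⟩

/-- Were every club `E` to fail, witnessed by a club `G E`, a decreasing chain of uncountable
cofinality with `E j ⊆ G (E i)` for `i < j` would stabilise all rungs of some glued ladder. -/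
theorem exists_isClub_gluedLadder_subset {ι : Type v} [LinearOrder ι] [WellFoundedLT ι]
    (hι : ℵ₀ < cof ι) (hια : #ι < cof α) {S : Set α} {a : α → ℕ → α}
    (hS : ∀ E, IsClub E → ∃ δ ∈ S, IsLUB (E ∩ Iio δ) δ) :
    ∃ E, IsClub E ∧ ∀ F, IsClub F →
      ∃ δ ∈ S, IsLUB (E ∩ Iio δ) δ ∧ gluedLadder E (a δ) ⊆ F := by
  by_contra! hcon
  choose! G hG hGS using hcon
  have hω : cof α ≠ ℵ₀ := ((hι.trans_le (cof_le_cardinalMk ι)).trans hια).ne'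
  have := noMaxOrder_of_aleph0_lt_cof hι
  have : Nonempty ι := cof_ne_zero_iff.1 hι.ne_bot
  obtain ⟨E, hE, hanti, hEG⟩ := exists_isClub_chain hω hια hG
  have hI : IsClub (⋂ i, E i) :=
    IsClub.iInter hω (by simpa only [Cardinal.lift_id] using hια) hE
  obtain ⟨δ, hδ, hlub⟩ := hS _ hI
  choose i hi using fun n => exists_forall_ge_isGreatest_iff hE hanti (a δ n)
  obtain ⟨s, hs⟩ := exists_forall_lt_of_mk_lt_cof (s := range i)
    ((countable_range i).le_aleph0.trans_lt hι)
  obtain ⟨t, hst⟩ := exists_gt s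
  refine hGS _ (hE s) δ hδ ⟨fun x hx => hx.2.le, fun b hb =>
    hlub.2 (upperBounds_mono_set (inter_subset_inter_left _ (iInter_subset E s)) hb)⟩ ?_
  rintro y ⟨n, hn⟩
  have his : i n ≤ s := (hs (i n) (mem_range_self n)).le
  exact hEG s t hst ((hi n t (his.trans hst.le) y).2 ((hi n s his y).1 hn)).1.1

theorem exists_strictMono_isLUB_inter_Iio (hω : ℵ₀ < cof α) (hE : IsClub E) :
    ∃ (a : ℕ → α) (δ : α), StrictMono a ∧ IsLUB (range a) δ ∧ IsLUB (E ∩ Iio δ) δ := by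
  have := noMaxOrder_of_aleph0_lt_cof hω
  have : Nonempty α := cof_ne_zero_iff.1 hω.ne_bot
  have hstep (b : α) : ∃ c, b < c ∧ c ∈ E := by
    obtain ⟨b', hb'⟩ := exists_gt b
    obtain ⟨c, hc, hc'⟩ := hE.isCofinal b'
    exact ⟨c, hb'.trans_le hc', hc⟩
  obtain ⟨e, he⟩ := hE.nonempty
  obtain ⟨a, δ, ha, rfl, haE, hδ⟩ := exists_strictMono_isLUB hω hstep e
  have hmem (n : ℕ) : a n ∈ E := n.casesOn he haE
  refine ⟨a, δ, ha, hδ, fun y hy => hy.2.le, fun b hb => hδ.2 ?_⟩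
  rintro _ ⟨n, rfl⟩
  exact hb ⟨hmem n, (ha n.lt_succ_self).trans_le (hδ.1 (mem_range_self _))⟩

end ClubGuessing

section Guessing

variable {κ : Cardinal.{u}} {S : Set (Below κ)} {C : Below κ → Set (Below κ)}

theorem mk_below (κ : Cardinal.{u}) : #(Below κ) = Cardinal.lift.{u + 1} κ := by
  simp [mk_Iio_ordinal]

theorem isRegularCardinalOrder_below (hreg : κ.IsRegular) : IsRegularCardinalOrder (Below κ) where
  type_lt_le_ord_cof := by
    rw [Ordinal.cof_Iio, ← Ordinal.lift_cof, hreg.cof_ord, ← lift_ord]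
    exact (Ordinal.type_lt_Iio κ.ord).le

theorem exists_isClubGuessing (hκ : ℵ₁ < cof (Below κ)) :
    ∃ (S : Set (Below κ)) (C : Below κ → Set (Below κ)), IsClubGuessing S C := by
  have hω : ℵ₀ < cof (Below κ) := aleph0_lt_aleph_one.trans hκ
  have := isRegularCardinalOrder_below isRegular_aleph_one.{u}
  have hℵ₁ : #(Below (ℵ₁ : Cardinal.{u})) = ℵ₁ := by simp
  let S : Set (Below κ) := {δ | ∃ a : ℕ → Below κ, StrictMono a ∧ IsLUB (range a) δ}
  choose! a hmono hlub using fun δ (hδ : δ ∈ S) => hδ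
  have hlt (δ) (hδ : δ ∈ S) (n : ℕ) : a δ n < δ :=
    (hmono δ hδ n.lt_succ_self).trans_le ((hlub δ hδ).1 (mem_range_self _))
  obtain ⟨E, hE, hguess⟩ := exists_isClub_gluedLadder_subset
    (ι := Below (ℵ₁ : Cardinal.{u})) (by rw [cof_eq_cardinalMk, hℵ₁]; exact aleph0_lt_aleph_one)
    (hℵ₁ ▸ hκ) (S := S) (a := a) fun E hE =>
      let ⟨f, δ, hf, hfδ, hEδ⟩ := exists_strictMono_isLUB_inter_Iio hω hE
      ⟨δ, ⟨f, hf, hfδ⟩, hEδ⟩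
  have hglue (δ) (hδ : δ ∈ S) (hEδ : IsLUB (E ∩ Iio δ) δ) : IsLUB (gluedLadder E (a δ)) δ :=
    isLUB_gluedLadder hE hEδ (hlt δ hδ) (hlub δ hδ)
  have hstat (F : Set (Below κ)) (hF : IsClub F) :
      IsStationary {δ | δ ∈ S ∩ {δ | IsLUB (E ∩ Iio δ) δ} ∧ gluedLadder E (a δ) ⊆ F} := by
    intro T hT
    obtain ⟨δ, hδ, hEδ, hsub⟩ := hguess _ (hF.inter hω.ne' hT)
    obtain ⟨y, hy, -⟩ := (lt_isLUB_iff (hglue δ hδ hEδ)).1 (hlt δ hδ 0)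
    exact ⟨δ, ⟨⟨hδ, hEδ⟩, hsub.trans inter_subset_left⟩,
      hT.isLUB_mem (hsub.trans inter_subset_right) ⟨y, hy⟩ (hglue δ hδ hEδ)⟩
  exact ⟨S ∩ {δ | IsLUB (E ∩ Iio δ) δ}, fun δ => gluedLadder E (a δ),
    { stationary := (hstat univ .univ).mono fun δ hδ => hδ.1
      subset := fun δ hδ => gluedLadder_subset_Iio (hlt δ hδ.1)
      isLUB := fun δ hδ => hglue δ hδ.1 hδ.2
      type_eq := fun δ hδ => nonempty_orderIso_nat_gluedLadder (hmono δ hδ.1).monotone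
        (hlt δ hδ.1) (hglue δ hδ.1 hδ.2)
      guess := hstat }⟩

theorem AlmostSubset.mono {c E F : Set (Below κ)} (h : AlmostSubset c E) (hEF : E ⊆ F) :
    AlmostSubset c F := by
  obtain ⟨β, hβ, h⟩ := h
  exact ⟨β, hβ, fun γ hγ hle => hEF (h γ hγ hle)⟩

/-- The ideal `id^b(C)`, bundled as an order ideal; intersections of clubs being clubs, it is
closed under unions. -/
def guessingIdeal (hω : ℵ₀ < cof (Below κ)) (S : Set (Below κ)) (C : Below κ → Set (Below κ)) :
    Order.Ideal (Set (Below κ)) where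
  carrier := {X | GuessingNull S C X}
  lower' := by
    rintro X Y hYX ⟨E, hE, h⟩
    exact ⟨E, hE, fun δ hδ => h δ ⟨hδ.1, hYX hδ.2⟩⟩
  nonempty' := ⟨∅, univ, .univ, fun δ hδ => hδ.2.elim⟩
  directed' := by
    rintro X ⟨E, hE, hX⟩ Y ⟨F, hF, hY⟩
    refine ⟨X ∪ Y, ⟨E ∩ F, hE.inter hω.ne' hF, ?_⟩, subset_union_left, subset_union_right⟩
    rintro δ ⟨⟨hS, hδE, hδF⟩, hδ | hδ⟩ h
    · exact hX δ ⟨⟨hS, hδE⟩, hδ⟩ (h.mono inter_subset_left)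
    · exact hY δ ⟨⟨hS, hδF⟩, hδ⟩ (h.mono inter_subset_right)

theorem isNormalIdeal_guessingIdeal [IsRegularCardinalOrder (Below κ)]
    (hω : ℵ₀ < cof (Below κ)) (hC : IsClubGuessing S C) :
    IsNormalIdeal (guessingIdeal hω S C) where
  proper := by
    rintro ⟨E, hE, h⟩
    obtain ⟨δ, ⟨hδ, hsub⟩, hδE⟩ := hC.guess E hE hE
    obtain ⟨f⟩ := hC.type_eq δ hδ
    exact h δ ⟨⟨hδ, hδE⟩, trivial⟩ ⟨f 0, (f 0).2, fun γ hγ _ => hsub hγ⟩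
  bounded β := by
    have := noMaxOrder_of_aleph0_lt_cof hω
    exact ⟨Ioi β, isClub_Ioi β, fun δ hδ => (lt_asymm (mem_Ioi.1 hδ.1.2) (mem_Iio.1 hδ.2)).elim⟩
  complete F hF hFI := by
    choose E hE h using fun X : F => hFI X X.2
    refine ⟨⋂ X : F, E X, IsClub.iInter hω.ne' (by simpa [mk_below] using hF) hE, ?_⟩
    rintro δ ⟨⟨hS, hδE⟩, X, hX, hδ⟩ hsub
    exact h ⟨X, hX⟩ δ ⟨⟨hS, mem_iInter.1 hδE _⟩, hδ⟩ (hsub.mono (iInter_subset _ _))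
  diagonal X hX := by
    choose E hE h using hX
    refine ⟨_, isClub_diagonal hω hE, ?_⟩
    rintro δ ⟨⟨hS, hδE⟩, α, hα, hδ⟩ ⟨β, hβ, hsub⟩
    -- Beyond `α`, every element of the diagonal intersection lies in `E α`.
    obtain ⟨γ, hγ, hlt⟩ := (lt_isLUB_iff (hC.isLUB δ hS)).1 (max_lt hα (hC.subset δ hS hβ))
    refine h α δ ⟨⟨hS, hδE α hα⟩, hδ⟩ ⟨γ, hγ, fun ε hε hle => ?_⟩
    have hlt' : max α β < ε := hlt.trans_le hle
    exact hsub ε hε (max_lt_iff.1 hlt').2.le α (max_lt_iff.1 hlt').1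

/-- The ladders `a δ`, for `δ ∈ S`, enumerate the sets `C δ` increasingly.  So that no ladder needs
a side condition, `a δ` is a monotone sequence with supremum `δ` also for `δ ∉ S`. -/
structure IsLadderSystem (S : Set (Below κ)) (C : Below κ → Set (Below κ))
    (a : Below κ → ℕ →o Below κ) : Prop where
  isLUB : ∀ δ, IsLUB (range (a δ)) δ
  strictMono : ∀ δ ∈ S, StrictMono (a δ)
  range_eq : ∀ δ ∈ S, range (a δ) = C δ

theorem IsClubGuessing.exists_isLadderSystem (hC : IsClubGuessing S C) :
    ∃ a, IsLadderSystem S C a := by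
  have hex (δ : Below κ) : ∃ a : ℕ →o Below κ,
      IsLUB (range a) δ ∧ (δ ∈ S → StrictMono a) ∧ (δ ∈ S → range a = C δ) := by
    by_cases hδ : δ ∈ S
    · obtain ⟨f⟩ := hC.type_eq δ hδ
      let a : ℕ →o Below κ := (OrderHom.Subtype.val (· ∈ C δ)).comp f
      have hrange : range a = C δ := by
        change range (Subtype.val ∘ f) = C δ
        rw [f.surjective.range_comp, Subtype.range_coe]
      exact ⟨a, hrange ▸ hC.isLUB δ hδ, fun _ => f.strictMono, fun _ => hrange⟩
    · refine ⟨OrderHom.const ℕ δ, ?_, fun h => (hδ h).elim, fun h => (hδ h).elim⟩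
      exact (range_const (ι := ℕ) (c := δ)).symm ▸ isLUB_singleton
  choose a hlub hmono hrange using hex
  exact ⟨a, hlub, hmono, hrange⟩

variable {a : Below κ → ℕ →o Below κ}

theorem IsLadderSystem.eventually_mem_of_almostSubset (ha : IsLadderSystem S C a) {δ : Below κ}
    (hδ : δ ∈ S) {E : Set (Below κ)} (h : AlmostSubset (C δ) E) :
    ∀ᶠ n in atTop, a δ n ∈ E := by
  obtain ⟨β, hβ, h⟩ := h
  rw [← ha.range_eq δ hδ] at hβ h
  obtain ⟨N, rfl⟩ := hβ
  exact eventually_atTop.2 ⟨N, fun n hn => h _ (mem_range_self n) ((a δ).monotone hn)⟩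

theorem IsLadderSystem.eventually_of_isClub (ha : IsLadderSystem S C a)
    (hω : ℵ₀ < cof (Below κ)) {E : Set (Below κ)} (hE : IsClub E) :
    ∀ᶠ δ in dualFilter (guessingIdeal hω S C), δ ∈ S ∧ ∀ᶠ n in atTop, a δ n ∈ E :=
  ⟨E, hE, fun _ hδ hsub => hδ.2 ⟨hδ.1.1, ha.eventually_mem_of_almostSubset hδ.1.1 hsub⟩⟩

end Guessing

section PowModFin

theorem PowModFin.mk_eq_mk_iff {X Y : Set ℕ} :
    (⟦X⟧ : PowModFin) = ⟦Y⟧ ↔ ∀ᶠ n in atTop, (n ∈ X ↔ n ∈ Y) := by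
  rw [← Nat.cofinite_eq_atTop, eventually_cofinite]
  refine Quotient.eq.trans (iff_of_eq (congrArg Set.Finite (ext fun n => ?_)))
  rw [mem_symmDiff, mem_ofPred_eq]
  tauto

theorem mk_powModFin : #PowModFin = 𝔠 := by
  refine le_antisymm ((mk_quotient_le (s := modFinSetoid)).trans (by simp)) ?_
  have hinj : Function.Injective fun X : Set ℕ => (⟦{n | n.unpair.1 ∈ X}⟧ : PowModFin) := by
    intro X Y h
    obtain ⟨N, hN⟩ := eventually_atTop.1 (PowModFin.mk_eq_mk_iff.1 h)
    ext n
    simpa using hN (Nat.pair n N) (Nat.right_le_pair n N)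
  have hle : #(Set ℕ) ≤ #PowModFin := mk_le_of_injective hinj
  simpa using hle

theorem nonempty_powModFin_equiv_real : Nonempty (PowModFin ≃ ℝ) :=
  Cardinal.eq.1 (mk_powModFin.trans mk_real.symm)

/-- The set of the odd numbers and of the doubles of the elements of `X`. -/
def padOdd (X : Set ℕ) : Set ℕ := {n | Odd n ∨ n / 2 ∈ X}

theorem padOdd_infinite (X : Set ℕ) : (padOdd X).Infinite :=
  infinite_of_forall_exists_gt fun n => ⟨2 * n + 1, Or.inl (odd_two_mul_add_one n), by omega⟩

/-- The map induced by `padOdd`, which embeds `P(ω)/fin` into the nonzero classes.  It is the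
encoding of elements of `P(ω)/fin` by traces of rays: a ray which does not converge to the
supremum of a ladder has a finite trace along it, so that the class of `∅` must not be a code. -/
def PowModFin.pad : PowModFin → PowModFin :=
  Quotient.map padOdd fun X Y h => by
    have h := mk_eq_mk_iff.1 (Quotient.sound h)
    refine Quotient.exact (mk_eq_mk_iff.2 ?_)
    filter_upwards [(Nat.tendsto_div_const_atTop two_ne_zero).eventually h] with n hn
    simp only [padOdd, mem_ofPred_eq, hn]

theorem PowModFin.pad_injective : Function.Injective pad := by
  intro y z
  induction y, z using Quotient.inductionOn₂ with | h X Y =>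
  intro h
  have htwo : Tendsto (2 * ·) atTop (atTop : Filter ℕ) := tendsto_id.const_mul_atTop' two_pos
  refine mk_eq_mk_iff.2 ((htwo.eventually (mk_eq_mk_iff.1 h)).mono fun n hn => ?_)
  simpa [padOdd, Nat.not_odd_iff_even.2 (even_two_mul n)] using hn

theorem PowModFin.mk_empty_ne_pad (z : PowModFin) : ⟦∅⟧ ≠ z.pad := by
  induction z using Quotient.inductionOn with | h X =>
  intro h
  have hempty : ∀ᶠ n in atTop, n ∉ padOdd X := (mk_eq_mk_iff.1 h).mono fun n hn => hn.2
  have hfreq := Nat.frequently_atTop_iff_infinite.2 (padOdd_infinite X)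
  obtain ⟨n, hn, hn'⟩ := (hempty.and_frequently hfreq).exists
  exact hn hn'

end PowModFin

section Traces

variable {L : Type v} [LinearOrder L] {a : ℕ →o L} {x y : ℕ → L}

/-- The set, modulo finite sets, of those intervals of the ladder `a` which are visited by the
sequence `x`. -/
def traceClass (a : ℕ →o L) (x : ℕ → L) : PowModFin :=
  ⟦{n | ∃ k, a n ≤ x k ∧ x k < a (n + 1)}⟧

theorem traceClass_eq_mk_iff {X : Set ℕ} :
    traceClass a x = ⟦X⟧ ↔ ∀ᶠ n in atTop, ((∃ k, a n ≤ x k ∧ x k < a (n + 1)) ↔ n ∈ X) :=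
  PowModFin.mk_eq_mk_iff

theorem traceClass_congr (h : ∀ᶠ n in atTop, ∀ k, x k < a n ↔ y k < a n) :
    traceClass a x = traceClass a y := by
  refine traceClass_eq_mk_iff.2 ?_
  filter_upwards [h, (tendsto_add_atTop_nat 1).eventually h] with n hn hn'
  simp only [← not_lt, hn, hn']

theorem eventually_not_visits (a : ℕ →o L) (z : L) :
    ∀ᶠ n in atTop, ¬(a n ≤ z ∧ z < a (n + 1)) := by
  by_cases h : ∃ m, z < a m
  · obtain ⟨m, hm⟩ := h
    filter_upwards [eventually_ge_atTop m] with n hn hz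
    exact (hm.trans_le (a.monotone hn)).not_ge hz.1
  · exact .of_forall fun n hz => h ⟨_, hz.2⟩

theorem traceClass_tail (a : ℕ →o L) (x : ℕ → L) (m : ℕ) :
    traceClass a (fun k => x (m + k)) = traceClass a x := by
  have hinit : ∀ᶠ n in atTop, ∀ k ∈ Iio m, ¬(a n ≤ x k ∧ x k < a (n + 1)) :=
    (finite_Iio m).eventually_all.2 fun k _ => eventually_not_visits a (x k)
  refine traceClass_eq_mk_iff.2 (hinit.mono fun n hn => ⟨fun ⟨k, hk⟩ => ⟨_, hk⟩, ?_⟩)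
  rintro ⟨k, hk⟩
  obtain ⟨j, rfl⟩ := Nat.exists_eq_add_of_le (not_lt.1 fun h => hn k h hk)
  exact ⟨j, hk⟩

theorem Ray.TailEquiv.traceClass_eq {V : Type u} {G : SimpleGraph V} {R S : Ray G}
    (h : R.TailEquiv S) (a : ℕ →o L) (g : V → L) :
    traceClass a (fun k => g (R.vert k)) = traceClass a fun k => g (S.vert k) := by
  obtain ⟨m, n, h⟩ := h
  rw [← traceClass_tail a _ m, ← traceClass_tail a (fun k => g (S.vert k)) n]
  simp only [h]

theorem traceClass_comp_nth (ha : StrictMono a) {X : Set ℕ} (hX : X.Infinite) :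
    traceClass a (fun j => a (Nat.nth (· ∈ X) j)) = ⟦X⟧ := by
  refine traceClass_eq_mk_iff.2 (.of_forall fun n => ?_)
  simp only [ha.le_iff_le, ha.lt_iff_lt, Nat.lt_succ_iff, ← le_antisymm_iff]
  simp only [eq_comm (a := n), ← mem_range, Nat.range_nth_of_infinite (p := (· ∈ X)) hX,
    ofPred_mem_eq]

theorem traceClass_eq_mk_empty {c : ℕ →o L} {δ ε : L} (ha : IsLUB (range a) δ)
    (hc : IsLUB (range c) ε) (hne : ε ≠ δ) : traceClass a c = ⟦∅⟧ := by
  rcases hne.lt_or_gt with h | h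
  · obtain ⟨_, ⟨M, rfl⟩, hM⟩ := (lt_isLUB_iff ha).1 h
    refine traceClass_eq_mk_iff.2 ((eventually_ge_atTop M).mono fun n hn => ?_)
    refine iff_of_false (fun ⟨k, hk, _⟩ => ?_) id
    exact (hM.trans_le ((a.monotone hn).trans hk)).not_ge (hc.1 (mem_range_self k))
  · obtain ⟨_, ⟨J, rfl⟩, hJ⟩ := (lt_isLUB_iff hc).1 h
    rw [← traceClass_tail a c J]
    refine traceClass_eq_mk_iff.2 (.of_forall fun n => iff_of_false (fun ⟨k, _, hk⟩ => ?_) id)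
    exact (hJ.trans_le (c.monotone (J.le_add_right k))).not_gt
      (hk.trans_le (ha.1 (mem_range_self _)))

end Traces

section Codes

variable {V : Type u} {W : Type w} {G : SimpleGraph V} {H : SimpleGraph W}

/-- The image, under a copy, of a ray in the neighbourhood of a vertex. -/
def Ray.mapNeighbor (f : SimpleGraph.Copy G H) {x : V}
    (R : Ray (G.induce (G.neighborSet x))) : Ray (H.induce (H.neighborSet (f x))) where
  vert n := ⟨f (R.vert n), f.toHom.map_adj (R.vert n).2⟩
  injective _ _ h := R.injective <| Subtype.ext <| f.injective <| congrArg Subtype.val h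
  adj n := f.toHom.map_adj (R.adj n)

theorem InClass.of_copy (f : SimpleGraph.Copy G H) (hH : InClass H) : InClass G := by
  intro x R S
  obtain ⟨m, n, h⟩ := hH _ (R.mapNeighbor f) (S.mapNeighbor f)
  exact ⟨m, n, fun k => Subtype.ext <| f.injective <| congrArg Subtype.val (h k)⟩

variable {L : Type v} [LinearOrder L]

/-- The elements of `P(ω)/fin` which are coded, along the ladder `a`, by the rays in the
neighbourhood of the vertex `x` of the graph `G` with labels `g`. -/
def codesAt (G : SimpleGraph V) (g : V → L) (a : ℕ →o L) (x : V) : Set PowModFin :=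
  {z | ∃ R : Ray (G.induce (G.neighborSet x)), traceClass a (fun k => g (R.vert k)) = z.pad}

/-- The elements of `P(ω)/fin` which are coded along the ladder `a` in the graph `G` with
labels `g`. -/
def codes (G : SimpleGraph V) (g : V → L) (a : ℕ →o L) : Set PowModFin :=
  ⋃ x, codesAt G g a x

theorem InClass.codesAt_subsingleton (hG : InClass G) (g : V → L) (a : ℕ →o L) (x : V) :
    (codesAt G g a x).Subsingleton := by
  rintro y ⟨R, hR⟩ z ⟨S, hS⟩
  exact PowModFin.pad_injective <|
    hR.symm.trans (((hG x R S).traceClass_eq a fun v => g v).trans hS)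

theorem InClass.mk_codes_le (hG : InClass G) (g : V → L) (a : ℕ →o L) :
    Cardinal.lift.{u} #(codes G g a) ≤ #V :=
  calc Cardinal.lift.{u} #(codes G g a)
    _ ≤ sum fun x => #(codesAt G g a x) := mk_iUnion_le_sum_mk_lift
    _ ≤ sum fun _ : V => 1 :=
      sum_le_sum _ _ fun x => mk_le_one_iff_set_subsingleton.2 (hG.codesAt_subsingleton g a x)
    _ = #V := by simp

theorem codes_subset_of_copy (f : SimpleGraph.Copy G H) {g : V → L} {h : W → L} {a : ℕ →o L}
    (hcut : ∀ᶠ n in atTop, ∀ x, g x < a n ↔ h (f x) < a n) : codes G g a ⊆ codes H h a := by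
  refine iUnion_subset fun x z ⟨R, hR⟩ => mem_iUnion.2 ⟨f x, R.mapNeighbor f, ?_⟩
  exact (traceClass_congr (hcut.mono fun n hn k => (hn (R.vert k)).symm)).trans hR

theorem codes_comp_iso (e : G ≃g H) (g : W → L) (a : ℕ →o L) :
    codes G (fun v => g (e v)) a = codes H g a :=
  (codes_subset_of_copy e.toCopy (.of_forall fun _ _ => .rfl)).antisymm
    (codes_subset_of_copy e.symm.toCopy (.of_forall fun n x => by simp))

end Codes

section BranchGraph

variable {A : Type v} {ι : Type w} {b : ι → ℕ → A}

theorem mem_res {x : ℕ → A} {n : ℕ} {y : A} : y ∈ PiNat.res x n ↔ ∃ j < n, x j = y := by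
  induction n with
  | zero => simp
  | succ n ih => simp only [PiNat.res_succ, List.mem_cons, ih, Nat.exists_lt_succ_right, or_comm,
      eq_comm (a := y)]

/-- The edges of the tree of lists, and those from the index of a branch to its nodes. -/
inductive BranchRel (b : ι → ℕ → A) : List A ⊕ ι → List A ⊕ ι → Prop
  | cons (x : A) (l : List A) : BranchRel b (.inl l) (.inl (x :: l))
  | branch (i : ι) (n : ℕ) : BranchRel b (.inr i) (.inl (PiNat.res (b i) n))

/-- The tree of lists together with a vertex, joined to the whole branch, for every branch from a
given family. -/
def branchGraph (b : ι → ℕ → A) : SimpleGraph (List A ⊕ ι) :=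
  SimpleGraph.fromRel (BranchRel b)

theorem branchGraph_adj_inl_inl {l m : List A} : (branchGraph b).Adj (.inl l) (.inl m) ↔
    (∃ x, m = x :: l) ∨ ∃ x, l = x :: m := by
  rw [branchGraph, SimpleGraph.fromRel_adj]
  constructor
  · rintro ⟨-, ⟨x, _⟩ | ⟨x, _⟩⟩
    exacts [.inl ⟨x, rfl⟩, .inr ⟨x, rfl⟩]
  · rintro (⟨x, rfl⟩ | ⟨x, rfl⟩)
    exacts [⟨by simp, .inl (.cons x l)⟩, ⟨by simp, .inr (.cons x m)⟩]

theorem branchGraph_adj_inr_iff {i : ι} {y : List A ⊕ ι} :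
    (branchGraph b).Adj (.inr i) y ↔ ∃ n, y = .inl (PiNat.res (b i) n) := by
  rw [branchGraph, SimpleGraph.fromRel_adj]
  constructor
  · rintro ⟨-, h | h⟩
    · cases h with | branch _ n => exact ⟨n, rfl⟩
    · cases h
  · rintro ⟨n, rfl⟩
    exact ⟨Sum.inr_ne_inl, .inl (.branch i n)⟩

theorem length_of_branchGraph_adj_inl_inl {l m : List A}
    (h : (branchGraph b).Adj (.inl l) (.inl m)) :
    m.length = l.length + 1 ∨ l.length = m.length + 1 := by
  obtain ⟨x, rfl⟩ | ⟨x, rfl⟩ := branchGraph_adj_inl_inl.1 h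
  exacts [.inl rfl, .inr rfl]

theorem eq_add_of_injective_of_step {k : ℕ → ℕ} (hinj : Function.Injective k)
    (hstep : ∀ n, k (n + 1) = k n + 1 ∨ k n = k (n + 1) + 1) (n : ℕ) : k n = k 0 + n := by
  have hup (n : ℕ) : k (n + 1) = k n + 1 := by
    refine (hstep n).resolve_right fun hdown => ?_
    -- After a step down, injectivity forces all later steps to go down.
    have hall (j : ℕ) : k (n + j) = k (n + (j + 1)) + 1 := by
      induction j with
      | zero => exact hdown
      | succ j ih =>
        refine (hstep (n + (j + 1))).resolve_left fun h => ?_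
        have := hinj (h.trans ih.symm)
        omega
    exact not_strictAnti_of_wellFoundedLT (fun j => k (n + j))
      (strictAnti_nat_of_succ_lt fun j => (Nat.lt_succ_self _).trans_eq (hall j).symm)
  induction n with
  | zero => rfl
  | succ n ih => rw [hup, ih, add_assoc]

theorem exists_ray_eq_res {i : ι}
    (R : Ray ((branchGraph b).induce ((branchGraph b).neighborSet (.inr i)))) :
    ∃ m, ∀ n, (R.vert n : List A ⊕ ι) = .inl (PiNat.res (b i) (m + n)) := by
  choose k hk using fun n => branchGraph_adj_inr_iff.1 (R.vert n).2
  have hinj : Function.Injective k := fun m n h => R.injective (Subtype.ext (by rw [hk, hk, h]))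
  have hstep (n : ℕ) : k (n + 1) = k n + 1 ∨ k n = k (n + 1) + 1 := by
    have hadj : (branchGraph b).Adj (R.vert n) (R.vert (n + 1)) := R.adj n
    rw [hk, hk] at hadj
    simpa only [PiNat.res_length] using length_of_branchGraph_adj_inl_inl hadj
  exact ⟨k 0, fun n => by rw [hk, eq_add_of_injective_of_step hinj hstep n]⟩

/-- The ray in the neighbourhood of the index of a branch. -/
def branchRay (b : ι → ℕ → A) (i : ι) :
    Ray ((branchGraph b).induce ((branchGraph b).neighborSet (.inr i))) where
  vert n := ⟨.inl (PiNat.res (b i) n), branchGraph_adj_inr_iff.2 ⟨n, rfl⟩⟩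
  injective m n h := by
    simpa using congrArg List.length (Sum.inl.inj (congrArg Subtype.val h))
  adj n := branchGraph_adj_inl_inl.2 (.inl ⟨b i n, rfl⟩)

theorem isEmpty_ray_neighborSet_inl (b : ι → ℕ → A) (l : List A) :
    IsEmpty (Ray ((branchGraph b).induce ((branchGraph b).neighborSet (.inl l)))) := by
  refine ⟨fun R => ?_⟩
  have hinj : Function.Injective fun n => (R.vert n : List A ⊕ ι) :=
    Subtype.val_injective.comp R.injective
  have hadj (n : ℕ) : (branchGraph b).Adj (R.vert n) (R.vert (n + 1)) := R.adj n
  -- Apart from the parent of `l`, which is visited at most once, the neighbours of `l` are its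
  -- children, no two of which are adjacent, and indices of branches, each with a single child.
  obtain ⟨N, hN⟩ := eventually_atTop.1 <| Nat.cofinite_eq_atTop ▸
    hinj.tendsto_cofinite.eventually (eventually_cofinite_ne (Sum.inl l.tail))
  have hlen (n : ℕ) (hn : N ≤ n) (m : List A) (hm : (R.vert n : List A ⊕ ι) = .inl m) :
      m.length = l.length + 1 := by
    have hlm : (branchGraph b).Adj (.inl l) (R.vert n) := (R.vert n).2
    rw [hm, branchGraph_adj_inl_inl] at hlm
    obtain ⟨x, rfl⟩ | ⟨x, rfl⟩ := hlm
    exacts [rfl, (hN n hn hm).elim]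
  have hinr (n : ℕ) (hn : N ≤ n) (i : ι) : (R.vert (n + 1) : List A ⊕ ι) ≠ .inr i := by
    intro hi
    have hchild (j : ℕ) (hj : N ≤ j) (h : (branchGraph b).Adj (R.vert (n + 1)) (R.vert j)) :
        (R.vert j : List A ⊕ ι) = .inl (PiNat.res (b i) (l.length + 1)) := by
      obtain ⟨k, hk⟩ := branchGraph_adj_inr_iff.1 (hi ▸ h)
      rw [hk, ← hlen j hj _ hk, PiNat.res_length]
    have heq := (hchild n hn (hadj n).symm).trans (hchild (n + 2) (by omega) (hadj (n + 1))).symm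
    have := hinj heq
    omega
  rcases h₁ : (R.vert (N + 1) : List A ⊕ ι) with m₁ | i
  · rcases h₂ : (R.vert (N + 2) : List A ⊕ ι) with m₂ | i
    · have := length_of_branchGraph_adj_inl_inl (h₁ ▸ h₂ ▸ hadj (N + 1))
      have := hlen _ (by omega) m₁ h₁
      have := hlen _ (by omega) m₂ h₂
      omega
    · exact hinr (N + 1) (by omega) i h₂
  · exact hinr N le_rfl i h₁

theorem inClass_branchGraph (b : ι → ℕ → A) : InClass (branchGraph b) := by
  rintro (l | i) R S
  · exact ((isEmpty_ray_neighborSet_inl b l).false R).elim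
  · obtain ⟨m, hm⟩ := exists_ray_eq_res R
    obtain ⟨n, hn⟩ := exists_ray_eq_res S
    exact ⟨n, m, fun k => Subtype.ext (by rw [hm, hn, add_left_comm])⟩

theorem mem_codes_branchGraph {L : Type v} [LinearOrder L] {g : List A ⊕ ι → L} {a : ℕ →o L}
    {z : PowModFin} : z ∈ codes (branchGraph b) g a ↔
      ∃ i, traceClass a (fun k => g (.inl (PiNat.res (b i) k))) = z.pad := by
  simp only [codes, mem_iUnion]
  constructor
  · rintro ⟨l | i, R, hR⟩
    · exact ((isEmpty_ray_neighborSet_inl b l).false R).elim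
    · refine ⟨i, Eq.trans ?_ hR⟩
      exact (inClass_branchGraph b _ (branchRay b i) R).traceClass_eq a fun y => g y
  · rintro ⟨i, hi⟩
    exact ⟨.inr i, branchRay b i, hi⟩

theorem traceClass_comp_res {L : Type v} [LinearOrder L] {g : List L → L} {a c : ℕ →o L}
    (hcut : ∀ᶠ n in atTop, ∀ l, g l < a n ↔ ∀ y ∈ l, y < a n) :
    traceClass a (fun k => g (PiNat.res c k)) = traceClass a c := by
  refine traceClass_eq_mk_iff.2 ?_
  filter_upwards [hcut, (tendsto_add_atTop_nat 1).eventually hcut] with n hn hn'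
  simp only [← not_lt, hn, hn', mem_res]
  constructor
  · intro ⟨k, hk, hk'⟩
    push Not at hk
    obtain ⟨_, ⟨j, hj, rfl⟩, hle⟩ := hk
    exact ⟨j, hle.not_gt, hk' _ ⟨j, hj, rfl⟩⟩
  · intro ⟨j, hj, hj'⟩
    refine ⟨j + 1, fun h => hj (h _ ⟨j, j.lt_succ_self, rfl⟩), ?_⟩
    rintro _ ⟨i, hi, rfl⟩
    exact (c.monotone (Nat.lt_succ_iff.1 hi)).trans_lt hj'

end BranchGraph

section CodingGraph

variable {L : Type v} [LinearOrder L] {a : ℕ →o L}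

/-- The increasing enumeration of those values of the ladder `a` whose indices belong to the
padding of a representative of `z`. -/
noncomputable def codingBranch (a : ℕ →o L) (z : PowModFin) : ℕ →o L :=
  a.comp ⟨Nat.nth (· ∈ padOdd z.out), (Nat.nth_strictMono (padOdd_infinite z.out)).monotone⟩

theorem traceClass_codingBranch (ha : StrictMono a) (z : PowModFin) :
    traceClass a (codingBranch a z) = z.pad :=
  (traceClass_comp_nth ha (padOdd_infinite z.out)).trans (congrArg PowModFin.pad z.out_eq)

theorem isLUB_range_codingBranch {δ : L} (ha : IsLUB (range a) δ) (z : PowModFin) :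
    IsLUB (range (codingBranch a z)) δ := by
  refine ⟨forall_mem_range.2 fun n => ha.1 (mem_range_self _), fun y hy => ha.2 ?_⟩
  exact forall_mem_range.2 fun n =>
    (a.monotone (Nat.nth_strictMono (padOdd_infinite z.out)).le_apply).trans (hy (mem_range_self n))

/-- The branch graph in which, for all `δ` and `z ∈ s δ`, the class `z` is coded by a branch along
the ladder `a δ`. -/
noncomputable def codingGraph (a : L → ℕ →o L) (s : L → Set PowModFin) :
    SimpleGraph (List L ⊕ Σ δ, s δ) :=
  branchGraph fun i => codingBranch (a i.1) i.2

theorem codes_codingGraph {a : L → ℕ →o L} (hlub : ∀ δ, IsLUB (range (a δ)) δ)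
    {s : L → Set PowModFin} {g : (List L ⊕ Σ δ, s δ) → L} {δ : L} (hδ : StrictMono (a δ))
    (hcut : ∀ᶠ n in atTop, ∀ l, g (.inl l) < a δ n ↔ ∀ y ∈ l, y < a δ n) :
    codes (codingGraph a s) g (a δ) = s δ := by
  ext z
  simp only [codingGraph, mem_codes_branchGraph,
    traceClass_comp_res (g := fun l => g (.inl l)) hcut]
  constructor
  · rintro ⟨⟨ε, y⟩, h⟩
    obtain rfl : ε = δ := by
      by_contra hne
      exact z.mk_empty_ne_pad <| h ▸ (traceClass_eq_mk_empty (hlub δ)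
        (isLUB_range_codingBranch (hlub ε) y) hne).symm
    rw [traceClass_codingBranch hδ] at h
    exact PowModFin.pad_injective h ▸ y.2
  · intro hz
    exact ⟨⟨δ, z, hz⟩, traceClass_codingBranch hδ z⟩

end CodingGraph

section SmallSubsets

variable {κ : Cardinal.{u}} {I : Order.Ideal (Set (Below κ))} {A B : Type v}

theorem mk_sigma_smallSubsets_le (hκ : ℵ₀ ≤ κ) (s : Below κ → SmallSubsets A κ) :
    #(Σ δ, (s δ).1) ≤ Cardinal.lift.{max (u + 1) v} κ :=
  calc #(Σ δ, (s δ).1)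
    _ = sum fun δ => Cardinal.lift.{u} #(s δ).1 := by
      rw [mk_sigma]
      exact (Cardinal.lift_id'.{u, max (u + 1) v} _).symm.trans (Cardinal.lift_sum.{u + 1, v, u} _)
    _ ≤ sum fun _ : Below κ => Cardinal.lift.{v, u} κ := sum_le_sum _ _ fun δ => (s δ).2
    _ = Cardinal.lift.{max (u + 1) v} κ := by
      simp [mul_eq_self, hκ]

theorem positivePart_mono {s t : Below κ → SmallSubsets A κ}
    (h : ∀ᶠ δ in dualFilter I, s δ ≤ t δ) : positivePart I s ⊆ positivePart I t := by
  intro x hx hxt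
  have hxt' : ∀ᶠ δ in dualFilter I, x ∉ (t δ).1 := by
    simpa only [Filter.Eventually, dualFilter, mem_comk, compl_ofPred, not_not] using hxt
  refine hx ?_
  have hxs : ∀ᶠ δ in dualFilter I, x ∉ (s δ).1 := (h.and hxt').mono fun δ hδ hs => hδ.2 (hδ.1 hs)
  simpa only [Filter.Eventually, dualFilter, mem_comk, compl_ofPred, not_not] using hxs

theorem positivePart_subset_iUnion (s : Below κ → SmallSubsets A κ) :
    positivePart I s ⊆ ⋃ δ, (s δ).1 := by
  intro x hx
  by_contra hs
  refine hx ?_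
  rw [eq_empty_of_forall_notMem (s := {δ | x ∈ (s δ).1}) fun δ h => hs (mem_iUnion.2 ⟨δ, h⟩)]
  exact I.bot_mem

theorem mk_positivePart_le (hκ : ℵ₀ ≤ κ) (s : Below κ → SmallSubsets A κ) :
    Cardinal.lift.{u} #(positivePart I s) ≤ Cardinal.lift.{v} κ := by
  rw [← Cardinal.lift_le.{u + 1}, Cardinal.lift_lift, Cardinal.lift_lift]
  calc Cardinal.lift.{u + 1} #(positivePart I s)
    _ ≤ Cardinal.lift.{u + 1} #(⋃ δ, (s δ).1) :=
      Cardinal.lift_le.2 (mk_le_mk_of_subset (positivePart_subset_iUnion s))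
    _ ≤ #(Σ δ, (s δ).1) := mk_iUnion_le_sum_mk_lift.trans (mk_sigma _).ge
    _ ≤ Cardinal.lift.{max (u + 1) v} κ := mk_sigma_smallSubsets_le hκ s

/-- The homomorphism from the reduced power sending the class of a sequence to its positive
part. -/
noncomputable def positivePartHom (hκ : ℵ₀ ≤ κ) : ReducedPower A I →o SmallSubsets A κ where
  toFun f := f.liftOn (fun s => ⟨positivePart I s, mk_positivePart_le hκ s⟩) fun _ _ h =>
    Subtype.ext ((positivePart_mono (h.mono fun _ => le_of_eq)).antisymm
      (positivePart_mono (h.mono fun _ => ge_of_eq)))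
  monotone' f g := Germ.inductionOn₂ f g fun _ _ => positivePart_mono

theorem positivePartHom_surjective (hκ : ℵ₀ ≤ κ) (hI : Set.univ ∉ I) :
    Function.Surjective (positivePartHom hκ : ReducedPower A I →o SmallSubsets A κ) := by
  intro B
  refine ⟨((fun _ => B : Below κ → SmallSubsets A κ) : ReducedPower A I), Subtype.ext ?_⟩
  change positivePart I (fun _ => B) = B.1
  ext x
  by_cases hx : x ∈ B.1
  · simpa [positivePart, hx] using hI
  · simpa [positivePart, hx] using I.bot_mem

/-- The action of a bijection on the small subsets. -/
def smallSubsetsIso (e : A ≃ B) (κ : Cardinal.{u}) : SmallSubsets A κ ≃o SmallSubsets B κ where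
  toEquiv := (Equiv.Set.congr e).subtypeEquiv fun s => by
    rw [Equiv.Set.congr_apply, mk_image_eq e.injective]
  map_rel_iff' := image_subset_image_iff e.injective

/-- The action of a bijection on the reduced powers. -/
def reducedPowerHom (I : Order.Ideal (Set (Below κ))) (e : A ≃ B) :
    ReducedPower A I →o ReducedPower B I where
  toFun := Germ.map (smallSubsetsIso e κ)
  monotone' f g := Germ.inductionOn₂ f g fun _ _ h =>
    Eventually.mono h fun _ hδ => (smallSubsetsIso e κ).monotone hδ

theorem reducedPowerHom_surjective (e : A ≃ B) : Function.Surjective (reducedPowerHom I e) := by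
  intro f
  induction f using Germ.inductionOn with | h s =>
  refine ⟨((fun δ => (smallSubsetsIso e κ).symm (s δ) : Below κ → SmallSubsets A κ) :
    ReducedPower A I), congrArg Germ.ofFun (funext fun δ => ?_)⟩
  exact (smallSubsetsIso e κ).apply_symm_apply (s δ)

theorem positivePartHom_reducedPowerHom (hκ : ℵ₀ ≤ κ) (e : A ≃ B) (f : ReducedPower A I) :
    positivePartHom hκ (reducedPowerHom I e f) = smallSubsetsIso e κ (positivePartHom hκ f) := by
  induction f using Germ.inductionOn with | h s =>
  refine Subtype.ext ?_
  change positivePart I (fun δ => smallSubsetsIso e κ (s δ)) = e '' positivePart I s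
  ext x
  obtain ⟨y, rfl⟩ := e.surjective x
  rw [e.injective.mem_set_image]
  change {δ | e y ∈ e '' (s δ).1} ∉ I ↔ {δ | y ∈ (s δ).1} ∉ I
  simp only [e.injective.mem_set_image]

end SmallSubsets

section CodeHom

variable {κ : Cardinal.{u}} {S : Set (Below κ)} {C : Below κ → Set (Below κ)}
  {a : Below κ → ℕ →o Below κ}

theorem ClassGraph.nonempty_equiv_below (G : ClassGraph κ) : Nonempty (G.V ≃ Below κ) :=
  Cardinal.lift_mk_eq'.1 (by rw [mk_below, G.card_eq, Cardinal.lift_lift])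

/-- A labelling of the vertices of a graph by the ordinals below its cardinality. -/
noncomputable def ClassGraph.label (G : ClassGraph κ) : G.V ≃ Below κ :=
  G.nonempty_equiv_below.some

/-- The sequence of the sets coded by a graph along the ladders `a δ`. -/
noncomputable def ClassGraph.codeSeq (a : Below κ → ℕ →o Below κ) (G : ClassGraph κ)
    (δ : Below κ) : SmallSubsets PowModFin κ :=
  ⟨codes G.graph G.label (a δ), by
    simpa [G.card_eq] using G.inClass.mk_codes_le G.label (a δ)⟩

theorem exists_classGraph {W : Type w} {G : SimpleGraph W} (hG : InClass G)
    (hW : Cardinal.lift.{u} #W = Cardinal.lift.{w} κ) :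
    ∃ H : ClassGraph κ, Nonempty (G ≃g H.graph) := by
  obtain ⟨e⟩ : Nonempty (W ≃ κ.out) := Cardinal.lift_mk_eq'.1 (by simpa using hW)
  exact ⟨⟨κ.out, G.map e.toEmbedding, by simp,
    hG.of_copy (SimpleGraph.Iso.map e G).symm.toCopy⟩, ⟨SimpleGraph.Iso.map e G⟩⟩

theorem exists_classGraph_codingGraph (hκ : ℵ₀ ≤ κ) (a : Below κ → ℕ →o Below κ)
    (s : Below κ → SmallSubsets PowModFin κ) :
    ∃ G : ClassGraph κ, Nonempty (codingGraph a (fun δ => (s δ).1) ≃g G.graph) := by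
  have hinf : ℵ₀ ≤ #(Below κ) := by simpa [mk_below] using hκ
  have : Infinite (Below κ) := infinite_iff.2 hinf
  have hle : #(Σ δ, (s δ).1) ≤ #(Below κ) :=
    (mk_sigma_smallSubsets_le hκ s).trans_eq (mk_below κ).symm
  refine exists_classGraph (inClass_branchGraph _) ?_
  rw [mk_sum, Cardinal.lift_id, Cardinal.lift_id, mk_list_eq_mk, add_eq_left hinf hle, mk_below,
    Cardinal.lift_lift]

variable [IsRegularCardinalOrder (Below κ)]

theorem IsLadderSystem.eventually_codeSeq_le (ha : IsLadderSystem S C a)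
    (hω : ℵ₀ < cof (Below κ)) {G H : ClassGraph κ} (h : G.graph.IsContained H.graph) :
    ∀ᶠ δ in dualFilter (guessingIdeal hω S C), G.codeSeq a δ ≤ H.codeSeq a δ := by
  obtain ⟨f⟩ := h
  let φ : Below κ → Below κ := fun x => H.label (f (G.label.symm x))
  have hφ : φ.Injective := H.label.injective.comp (f.injective.comp G.label.symm.injective)
  filter_upwards [ha.eventually_of_isClub hω (isClub_lt_iff_lt hω
    (mk_preimage_singleton_lt_cof hω Function.injective_id)
    (mk_preimage_singleton_lt_cof hω hφ))] with δ ⟨_, hδ⟩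
  refine codes_subset_of_copy f (hδ.mono fun n hn x => ?_)
  simpa [φ] using hn (G.label x)

/-- The homomorphism sending the isomorphism type of a graph to the class of the sequence of the
sets coded by it. -/
noncomputable def codeHom (hω : ℵ₀ < cof (Below κ)) (ha : IsLadderSystem S C a) :
    IsoTypes κ →o ReducedPower PowModFin (guessingIdeal hω S C) where
  toFun := Quotient.lift (fun G => (G.codeSeq a : ReducedPower PowModFin (guessingIdeal hω S C)))
    fun _ _ ⟨e⟩ => le_antisymm (ha.eventually_codeSeq_le hω ⟨e.toCopy⟩)
      (ha.eventually_codeSeq_le hω ⟨e.symm.toCopy⟩)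
  monotone' s t := Quotient.inductionOn₂ s t fun _ _ h => ha.eventually_codeSeq_le hω h

theorem codeHom_surjective (hκ : ℵ₀ ≤ κ) (hω : ℵ₀ < cof (Below κ)) (ha : IsLadderSystem S C a) :
    Function.Surjective (codeHom hω ha) := by
  intro F
  induction F using Germ.inductionOn with | h s =>
  obtain ⟨G, ⟨e⟩⟩ := exists_classGraph_codingGraph hκ a s
  refine ⟨⟦G⟧, Germ.coe_eq.2 ?_⟩
  have hinj : Function.Injective fun l => G.label (e (.inl l)) :=
    G.label.injective.comp (e.injective.comp Sum.inl_injective)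
  filter_upwards [ha.eventually_of_isClub hω (isClub_list_lt_iff hω hinj)] with δ ⟨hδS, hδ⟩
  exact Subtype.ext <| (codes_comp_iso e G.label (a δ)).symm.trans
    (codes_codingGraph ha.isLUB (ha.strictMono δ hδS) hδ)

end CodeHom

end RayGraphs

theorem theorem1p10 (κ : Cardinal.{u}) (hreg : κ.IsRegular) (hκ : ℵ₁ < κ) :
    ∃ (S : Set (RayGraphs.Below κ)) (C : RayGraphs.Below κ → Set (RayGraphs.Below κ))
      (I : Order.Ideal (Set (RayGraphs.Below κ)))
      (Φ : RayGraphs.IsoTypes κ →o RayGraphs.SmallSubsets ℝ κ),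
      RayGraphs.IsClubGuessing S C ∧
      (∀ X : Set (RayGraphs.Below κ), X ∈ I ↔ RayGraphs.GuessingNull S C X) ∧
      RayGraphs.IsNormalIdeal I ∧
      Function.Surjective Φ ∧
      (∃ (φ : RayGraphs.IsoTypes κ →o RayGraphs.ReducedPower ℝ I)
        (ψ : RayGraphs.ReducedPower ℝ I →o RayGraphs.SmallSubsets ℝ κ),
        Function.Surjective φ ∧ Function.Surjective ψ ∧ Φ = ψ.comp φ ∧
        ∀ s : RayGraphs.Below κ → RayGraphs.SmallSubsets ℝ κ,
          (ψ (s : RayGraphs.ReducedPower ℝ I) : Set ℝ) = RayGraphs.positivePart I s) ∧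
      (∃ (e : RayGraphs.PowModFin ≃ ℝ)
        (φ : RayGraphs.IsoTypes κ →o RayGraphs.ReducedPower RayGraphs.PowModFin I)
        (ψ : RayGraphs.ReducedPower RayGraphs.PowModFin I →o RayGraphs.SmallSubsets ℝ κ),
        Function.Surjective φ ∧ Function.Surjective ψ ∧ Φ = ψ.comp φ ∧
        ∀ s : RayGraphs.Below κ → RayGraphs.SmallSubsets RayGraphs.PowModFin κ,
          (ψ (s : RayGraphs.ReducedPower RayGraphs.PowModFin I) : Set ℝ) =
            e '' RayGraphs.positivePart I s) := by
  have := RayGraphs.isRegularCardinalOrder_below hreg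
  have hcof : ℵ₁ < Order.cof (RayGraphs.Below κ) := by
    rw [Order.cof_eq_cardinalMk, RayGraphs.mk_below]
    exact Cardinal.aleph_one_lt_lift.2 hκ
  have hω : ℵ₀ < Order.cof (RayGraphs.Below κ) := aleph0_lt_aleph_one.trans hcof
  obtain ⟨S, C, hC⟩ := RayGraphs.exists_isClubGuessing hcof
  obtain ⟨a, ha⟩ := hC.exists_isLadderSystem
  obtain ⟨e⟩ := RayGraphs.nonempty_powModFin_equiv_real
  have hI := RayGraphs.isNormalIdeal_guessingIdeal hω hC
  let ψ (A : Type) := RayGraphs.positivePartHom (A := A) (I := RayGraphs.guessingIdeal hω S C)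
    hreg.aleph0_le
  have hψ (A : Type) : Function.Surjective (ψ A) :=
    RayGraphs.positivePartHom_surjective hreg.aleph0_le hI.proper
  let φ := RayGraphs.codeHom hω ha
  have hφ : Function.Surjective φ := RayGraphs.codeHom_surjective hreg.aleph0_le hω ha
  let φR := (RayGraphs.reducedPowerHom _ e).comp φ
  have hφR : Function.Surjective φR := (RayGraphs.reducedPowerHom_surjective e).comp hφ
  let e' := RayGraphs.smallSubsetsIso e κ
  exact ⟨S, C, RayGraphs.guessingIdeal hω S C, (ψ ℝ).comp φR, hC, fun X => Iff.rfl, hI,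
    (hψ ℝ).comp hφR, ⟨φR, ψ ℝ, hφR, hψ ℝ, rfl, fun s => rfl⟩,
    e, φ, e'.toOrderEmbedding.toOrderHom.comp (ψ _), hφ, e'.surjective.comp (hψ _),
    OrderHom.ext _ _ (funext fun t => RayGraphs.positivePartHom_reducedPowerHom _ e (φ t)),
    fun s => rfl⟩
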